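/- Let $S$ be the set of positive rational numbers $a$ for which there exist positive rational initial conditions $x_0,x_1$ such that the sequence $(x_n)_{n\ge 0}$ generated by the Lyness recurrence $x_{n+2}=(a+x_{n+1})/x_n$ is $9$-periodic, in the sense that its least positive period is $9$. Then $S$ is infinite. Furthermore, the closure of $S$ in $\mathbb{R}$ contains the interval $[a_1,+\infty)$, where $a_1\simeq 5.41147624$ is the largest real root of $a^3-\frac{2019}{529}a^2-\frac{777}{92}a-1$. -/

import Mathlib

/-- The sequence generated by the Lyness recurrence `x (n + 2) = (a + x (n + 1)) / x n` with
initial conditions `x 0 = x₀` and `x 1 = x₁`. For `a, x₀, x₁ > 0` all terms are positive, so no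
division by zero ever takes place. -/
def lynessSeq (a x₀ x₁ : ℚ) : ℕ → ℚ
  | 0 => x₀
  | 1 => x₁
  | n + 2 => (a + lynessSeq a x₀ x₁ (n + 1)) / lynessSeq a x₀ x₁ n

/-- The sequence `x` is `p`-periodic, in the sense of prime period: `p` is its least positive
period. -/
def HasPrimePeriod (x : ℕ → ℚ) (p : ℕ) : Prop :=
  IsLeast {q : ℕ | 0 < q ∧ Function.Periodic x q} p

/-- The positive rational parameters `a` for which some positive rational initial conditions
generate a Lyness sequence of prime period `9`. -/
def lynessNinePeriodicParams : Set ℚ :=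
  {a | 0 < a ∧ ∃ x₀ x₁ : ℚ, 0 < x₀ ∧ 0 < x₁ ∧ HasPrimePeriod (lynessSeq a x₀ x₁) 9}

/-! The Lyness map preserves `(x + 1) * (y + 1) * (x + y + a) / (x * y)`, and on one explicit level
of this invariant every positive orbit has period 9. Cutting that level by the line `x + y = 23 / 4`
leaves a single unknown `d = x - y`, and `a = 4 - 7488 / X` turns the resulting relation between `a`
and `d` into an elliptic curve `Y ^ 2 = X ^ 3 + ...`. Its rational points with `X < 0` give
parameters `a > 4` in the set; `a → ∞` is `X → 0` from the left, and `a₁` is a root of the cubic in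
`X`.

It remains to show that rational points are dense on the arc over `X ≤ 0` where the cubic is
positive. A rational point that is not 2-integral gives infinitely many by doubling. By compactness
some sums or differences of these lie arbitrarily far out (`IsChordClosed.exists_fst_gt`). Adding
such a point repeatedly to the rational point over `X = 0` walks left along the arc in arbitrarily
small steps (`chordSum_step`, `IsChordClosed.exists_near`). Infinitude of the set follows from the
density. -/

/-! ### Period nine for the Lyness recurrence -/

lemma lynessSeq_add_two (a x y : ℚ) (n : ℕ) :
    lynessSeq a x y (n + 2) = (a + lynessSeq a x y (n + 1)) / lynessSeq a x y n := by
  rw [lynessSeq]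

lemma lynessSeq_nine_ten {a x y : ℚ} (ha : 0 < a) (hx : 0 < x) (hy : 0 < y)
    (h : a * (x + 1) * (y + 1) * (x + y + a) = (a - 1) * (a ^ 2 - a + 1) * (x * y)) :
    lynessSeq a x y 9 = x ∧ lynessSeq a x y 10 = y := by
  have u0 : lynessSeq a x y 0 = x := by rw [lynessSeq]
  have u1 : lynessSeq a x y 1 = y := by rw [lynessSeq]
  have u2 : lynessSeq a x y 2 = (a + y) / x := by rw [lynessSeq_add_two, u0, u1]
  have u3 : lynessSeq a x y 3 = (a * x + a + y) / (x * y) := by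
    rw [lynessSeq_add_two, u1, u2]; field_simp; ring
  have u4 : lynessSeq a x y 4 = (a * x * y + a * x + a + y) / (y * (a + y)) := by
    rw [lynessSeq_add_two, u2, u3]; field_simp; ring
  -- By reversibility, the term of index `1 - n` is the term of index `n` with `x` and `y` swapped.
  -- So `u5` to `u8` assert that the orbit agrees with its backward continuation; `h` is needed only
  -- to match the terms of index 5 and 6 with those of index -4 and -3.
  have u5 : lynessSeq a x y 5 =
      y * (a * x * (a + x) + a * x * y + a * y + a + x) / ((a + x) * (a * y + a + x)) := by
    rw [lynessSeq_add_two, u3, u4]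
    have : 0 < a * x + a + y := by positivity
    field_simp
    linear_combination (x - y) * (a + x + y) * h
  have u6 : lynessSeq a x y 6 = (a * x * y + a * y + a + x) / (x * (a + x)) := by
    rw [lynessSeq_add_two, u4, u5]
    have : 0 < a * x * y + a * x + a + y := by positivity
    field_simp
    linear_combination -(a * y + a - y ^ 2 * x + x) * h
  have u7 : lynessSeq a x y 7 = (a * y + a + x) / (x * y) := by
    rw [lynessSeq_add_two, u5, u6]
    have : 0 < a * x * (a + x) + a * x * y + a * y + a + x := by positivity
    field_simp
    ring
  have u8 : lynessSeq a x y 8 = (a + x) / y := by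
    rw [lynessSeq_add_two, u6, u7]
    have : 0 < a * x * y + a * y + a + x := by positivity
    field_simp
    ring
  have u9 : lynessSeq a x y 9 = x := by
    rw [lynessSeq_add_two, u7, u8]
    have : 0 < a * y + a + x := by positivity
    field_simp
    ring
  refine ⟨u9, ?_⟩
  rw [lynessSeq_add_two, u8, u9]
  field_simp

lemma lynessSeq_periodic_of_eq {a x y : ℚ} {p : ℕ} (h0 : lynessSeq a x y p = x)
    (h1 : lynessSeq a x y (p + 1) = y) : Function.Periodic (lynessSeq a x y) p := by
  have key : ∀ n, lynessSeq a x y (n + p) = lynessSeq a x y n ∧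
      lynessSeq a x y (n + 1 + p) = lynessSeq a x y (n + 1) := by
    intro n
    induction n with
    | zero =>
      refine ⟨by rw [Nat.zero_add, h0, lynessSeq], ?_⟩
      rw [show 0 + 1 + p = p + 1 by ring, h1, lynessSeq]
    | succ n ih =>
      refine ⟨ih.2, ?_⟩
      rw [show n + 1 + 1 + p = n + p + 2 by ring, lynessSeq_add_two, ih.1,
        show n + p + 1 = n + 1 + p by ring, ih.2, lynessSeq_add_two a x y n]
  exact fun n => (key n).1

/-- Subtracting consecutive relations makes the differences of terms vanish, so only fixed points
have period 3. -/
lemma eq_of_lynessSeq_periodic_three {a x y : ℚ} (hx : 0 < x) (hy : 0 < y)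
    (h : Function.Periodic (lynessSeq a x y) 3) : x = y ∧ x ^ 2 = a + x := by
  have u0 : lynessSeq a x y 0 = x := by rw [lynessSeq]
  have u1 : lynessSeq a x y 1 = y := by rw [lynessSeq]
  have h0 := h 0
  have h1 := h 1
  have e2 := lynessSeq_add_two a x y 0
  have e3 := lynessSeq_add_two a x y 1
  have e4 := lynessSeq_add_two a x y 2
  simp only [zero_add, Nat.reduceAdd] at h0 h1 e2 e3 e4
  rw [h0, u0] at e3 e4
  rw [h1, u1] at e4
  rw [u1] at e3
  rw [u1, u0] at e2
  set z := lynessSeq a x y 2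
  have k2 : z * x = a + y := by rw [e2]; field_simp
  have k3 : x * y = a + z := by rw [eq_div_iff hy.ne'] at e3; exact e3
  have hz : z ≠ 0 := by
    intro hz
    rw [hz, div_zero] at e4
    exact hy.ne' e4
  have k4 : y * z = a + x := by rw [eq_div_iff hz] at e4; exact e4
  have hzy : z = y := by
    have : (x + 1) * (z - y) = 0 := by linear_combination k2 - k3
    rcases mul_eq_zero.1 this with h | h <;> linarith
  have hxy : x = y := by
    have : (y + 1) * (x - y) = 0 := by
      rw [hzy] at k3 k4
      linear_combination k3 - k4
    rcases mul_eq_zero.1 this with h | h <;> linarith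
  refine ⟨hxy, ?_⟩
  rw [hzy, ← hxy] at k4
  linear_combination k4

/-- For `0 < q < 9`, `gcd q 9` divides 3, so periods `q` and 9 together force period 3. -/
lemma hasPrimePeriod_nine {u : ℕ → ℚ} (h9 : Function.Periodic u 9)
    (h3 : ¬ Function.Periodic u 3) : HasPrimePeriod u 9 := by
  refine ⟨⟨by norm_num, h9⟩, ?_⟩
  rintro q ⟨hq0, hq⟩
  by_contra! hlt
  apply h3
  intro n
  obtain ⟨k, m, hkm⟩ : ∃ k m : ℕ, k * q = 3 + m * 9 := by
    interval_cases q
    · exact ⟨3, 0, rfl⟩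
    · exact ⟨6, 1, rfl⟩
    · exact ⟨1, 0, rfl⟩
    · exact ⟨3, 1, rfl⟩
    · exact ⟨6, 3, rfl⟩
    · exact ⟨2, 1, rfl⟩
    · exact ⟨3, 2, rfl⟩
    · exact ⟨6, 5, rfl⟩
  have e1 := h9.nat_mul m (n + 3)
  have e2 := hq.nat_mul k n
  simp only [Nat.cast_id] at e1 e2
  rw [← e1, add_assoc, ← hkm, e2]

/-- The points with `x + y = 23 / 4` and `x - y = d` on the level set of the Lyness invariant on
which the map has period nine. -/
lemma mem_lynessNinePeriodicParams {a d : ℚ} (ha : 4 < a)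
    (hd : 16 * d ^ 2 * (2 * a + 1) ^ 2 * (a - 4) =
      2116 * a ^ 3 - 8076 * a ^ 2 - 17871 * a - 2116) :
    a ∈ lynessNinePeriodicParams := by
  have ha4 : 0 < a - 4 := by linarith
  have hprod : 0 < (23 / 4 + d) * (23 / 4 - d) := by
    have h1 : 0 < 4 * a * (27 * (23 / 4 + a)) := by positivity
    -- On the line `x + y = s` the coefficient of `x * y` is a cubic in `a`; for `s = 23 / 4` it is
    -- `(a - 4) * (a + 1 / 2) ^ 2`. The square factor is what brings the curve down to genus one.
    have h2 : (2 * a + 1) ^ 2 * (a - 4) * ((23 / 4 + d) * (23 / 4 - d)) =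
        4 * a * (27 * (23 / 4 + a)) := by linear_combination -hd / 16
    rw [← h2] at h1
    exact pos_of_mul_pos_right h1 (by positivity)
  obtain ⟨hp, hm⟩ : 0 < 23 / 4 + d ∧ 0 < 23 / 4 - d := by
    rcases pos_and_pos_or_neg_and_neg_of_mul_pos hprod with h | h
    · exact h
    · linarith [h.1, h.2]
  refine ⟨by linarith, (23 / 4 + d) / 2, (23 / 4 - d) / 2, by linarith, by linarith, ?_⟩
  obtain ⟨h0, h1⟩ := lynessSeq_nine_ten (a := a) (x := (23 / 4 + d) / 2) (y := (23 / 4 - d) / 2)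
    (by linarith) (by linarith) (by linarith) (by linear_combination hd / 256)
  refine hasPrimePeriod_nine (lynessSeq_periodic_of_eq h0 h1) fun h3 => ?_
  obtain ⟨hxy, hfix⟩ := eq_of_lynessSeq_periodic_three (by linarith) (by linarith) h3
  have hd0 : d = 0 := by linarith
  rw [hd0] at hd hfix
  have ha' : a = 345 / 64 := by linarith
  rw [ha'] at hd
  norm_num at hd

/-! ### Chord and tangent constructions -/

/-- The monic cubic `x ^ 3 + A x ^ 2 + B x + C`. -/
def monicCubic {K : Type*} [Field K] (A B C x : K) : K := x ^ 3 + A * x ^ 2 + B * x + C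

/-- The sum of two points with distinct abscissas on `y ^ 2 = x ^ 3 + A x ^ 2 + B x + C`, by the
chord construction. -/
def chordSum {K : Type*} [Field K] (A : K) (p q : K × K) : K × K :=
  let l := (q.2 - p.2) / (q.1 - p.1)
  let x := l ^ 2 - A - p.1 - q.1
  (x, -(p.2 + l * (x - p.1)))

/-- The set of affine points of `y ^ 2 = x ^ 3 + A x ^ 2 + B x + C`. -/
def cubicPoints {K : Type*} [Field K] (A B C : K) : Set (K × K) :=
  {p | p.2 ^ 2 = monicCubic A B C p.1}

lemma chordSum_mem_cubicPoints {K : Type*} [Field K] {A B C : K} {p q : K × K}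
    (hp : p ∈ cubicPoints A B C) (hq : q ∈ cubicPoints A B C) (h : p.1 ≠ q.1) :
    chordSum A p q ∈ cubicPoints A B C := by
  obtain ⟨x₁, y₁⟩ := p
  obtain ⟨x₂, y₂⟩ := q
  simp only [cubicPoints, chordSum, monicCubic, Set.mem_ofPred_eq] at *
  have hx : x₂ - x₁ ≠ 0 := sub_ne_zero.2 (Ne.symm h)
  set l := (y₂ - y₁) / (x₂ - x₁) with hl
  have hy : y₂ = y₁ + l * (x₂ - x₁) := by rw [hl]; field_simp; ring
  rw [hy] at hq
  apply mul_left_cancel₀ hx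
  linear_combination (x₂ - (l ^ 2 - A - x₁ - x₂)) * hp + ((l ^ 2 - A - x₁ - x₂) - x₁) * hq

lemma exists_double_mem_cubicPoints {K : Type*} [Field K] {A B C x y : K} (h2 : (2 : K) ≠ 0)
    (h : (x, y) ∈ cubicPoints A B C) (hy : y ≠ 0) :
    ∃ x' y', (x', y') ∈ cubicPoints A B C ∧
      4 * monicCubic A B C x * x' =
        x ^ 4 + (-2 * B * x ^ 2 - 8 * C * x + (B ^ 2 - 4 * A * C)) := by
  simp only [cubicPoints, monicCubic, Set.mem_ofPred_eq] at *
  obtain ⟨l, hl⟩ : ∃ l, 2 * y * l = 3 * x ^ 2 + 2 * A * x + B :=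
    ⟨(3 * x ^ 2 + 2 * A * x + B) / (2 * y), by field_simp⟩
  refine ⟨l ^ 2 - A - 2 * x, -(y + l * (l ^ 2 - A - 3 * x)), ?_, ?_⟩
  · linear_combination h + (l ^ 2 - A - 3 * x) * hl
  · rw [← h]
    linear_combination (2 * y * l + 3 * x ^ 2 + 2 * A * x + B) * hl - 4 * (A + 2 * x) * h

/-! ### Infinitely many rational points, by 2-adic growth under doubling -/

section TwoAdic

lemma padicNorm_two_add_eq_left {u v : ℚ} (h : padicNorm 2 v < padicNorm 2 u) :
    padicNorm 2 (u + v) = padicNorm 2 u := by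
  rw [padicNorm.add_eq_max_of_ne h.ne', max_eq_left h.le]

/-- A quadratic polynomial with integer coefficients is `2`-adically at most as large as `x ^ 2`
when `x` is large. -/
lemma padicNorm_two_quadratic_le (a b c : ℤ) {x : ℚ} (hx : 1 ≤ padicNorm 2 x) :
    padicNorm 2 (a * x ^ 2 + b * x + c) ≤ padicNorm 2 x ^ 2 := by
  have ha := padicNorm.of_int (p := 2) a
  have hb := padicNorm.of_int (p := 2) b
  have hc := padicNorm.of_int (p := 2) c
  have hn : ∀ q : ℚ, 0 ≤ padicNorm 2 q := padicNorm.nonneg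
  refine padicNorm.nonarchimedean.trans (max_le (padicNorm.nonarchimedean.trans (max_le ?_ ?_)) ?_)
  · rw [padicNorm.mul, pow_two, padicNorm.mul, ← pow_two]
    exact mul_le_of_le_one_left (by positivity) ha
  · rw [padicNorm.mul]
    nlinarith [hn x, hn b]
  · nlinarith

lemma exists_padicNorm_two_double {A B C : ℤ} {x y : ℚ}
    (h : (x, y) ∈ cubicPoints (A : ℚ) B C) (hx : 2 ≤ padicNorm 2 x) :
    ∃ x' y', (x', y') ∈ cubicPoints (A : ℚ) B C ∧ 4 * padicNorm 2 x ≤ padicNorm 2 x' := by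
  have hcub : padicNorm 2 (monicCubic (A : ℚ) B C x) = padicNorm 2 x ^ 3 := by
    have h1 := padicNorm_two_quadratic_le A B C (x := x) (by linarith)
    have h3 : padicNorm 2 (x ^ 3) = padicNorm 2 x ^ 3 := by
      simp only [pow_succ, pow_zero, one_mul, padicNorm.mul]
    rw [monicCubic, add_assoc, add_assoc, ← add_assoc ((A : ℚ) * x ^ 2),
      padicNorm_two_add_eq_left, h3]
    rw [h3]
    nlinarith [pow_pos (show 0 < padicNorm 2 x by linarith) 2]
  have hy : y ≠ 0 := by
    rintro rfl
    have h0 : monicCubic (A : ℚ) B C x = 0 := by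
      have : (0 : ℚ) ^ 2 = monicCubic (A : ℚ) B C x := h
      rw [← this]; norm_num
    rw [h0, padicNorm.zero] at hcub
    have : 0 < padicNorm 2 x ^ 3 := pow_pos (by linarith) 3
    linarith
  obtain ⟨x', y', h', hx'⟩ := exists_double_mem_cubicPoints two_ne_zero h hy
  refine ⟨x', y', h', ?_⟩
  have h4 : padicNorm 2 (x ^ 4) = padicNorm 2 x ^ 4 := by
    simp only [pow_succ, pow_zero, one_mul, padicNorm.mul]
  have hnum := padicNorm_two_quadratic_le (-2 * B) (-8 * C) (B ^ 2 - 4 * A * C) (x := x)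
    (by linarith)
  push_cast at hnum
  -- The leading terms dominate in the duplication formula `x' = (x ^ 4 + ...) / (4 * (x ^ 3 +
  -- ...))`, and the 4 in the denominator multiplies the norm by 4.
  have e := congrArg (padicNorm 2) hx'
  rw [show (-2 * (B : ℚ) * x ^ 2 - 8 * C * x + (B ^ 2 - 4 * A * C)) =
    -2 * (B : ℚ) * x ^ 2 + -8 * C * x + (B ^ 2 - 4 * A * C) by ring,
    padicNorm_two_add_eq_left (by
      rw [h4]
      nlinarith [pow_pos (show 0 < padicNorm 2 x by linarith) 2,
        pow_pos (show 0 < padicNorm 2 x by linarith) 3]), h4, padicNorm.mul, padicNorm.mul,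
    hcub, show (4 : ℚ) = ((2 : ℕ) : ℚ) * ((2 : ℕ) : ℚ) by norm_num, padicNorm.mul,
    padicNorm.padicNorm_p_of_prime] at e
  have hpos : 0 < padicNorm 2 x ^ 3 := pow_pos (by linarith) 3
  have : padicNorm 2 x ^ 3 * padicNorm 2 x' = padicNorm 2 x ^ 3 * (4 * padicNorm 2 x) := by
    push_cast at e
    linear_combination 4 * e
  exact (mul_left_cancel₀ hpos.ne' this).ge

/-- A rational point whose abscissa is not `2`-integral has infinitely many multiples. -/
lemma infinite_fst_image_cubicPoints {A B C : ℤ} {x y : ℚ}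
    (h : (x, y) ∈ cubicPoints (A : ℚ) B C) (hx : 2 ≤ padicNorm 2 x) :
    (Prod.fst '' cubicPoints (A : ℚ) B C).Infinite := by
  have key : ∀ n : ℕ, ∃ x' y', (x', y') ∈ cubicPoints (A : ℚ) B C ∧
      (n : ℚ) + 2 ≤ padicNorm 2 x' := by
    intro n
    induction n with
    | zero => exact ⟨x, y, h, by simpa using hx⟩
    | succ n ih =>
      obtain ⟨x₁, y₁, h₁, hx₁⟩ := ih
      have hn : (0 : ℚ) ≤ n := n.cast_nonneg
      obtain ⟨x₂, y₂, h₂, hx₂⟩ := exists_padicNorm_two_double h₁ (by linarith)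
      exact ⟨x₂, y₂, h₂, by push_cast; linarith⟩
  intro hfin
  obtain ⟨b, hb⟩ := (hfin.image (padicNorm 2)).bddAbove
  obtain ⟨n, hn⟩ := exists_nat_gt b
  obtain ⟨x', y', h', hx'⟩ := key n
  have : padicNorm 2 x' ≤ b := hb ⟨x', ⟨(x', y'), h', rfl⟩, rfl⟩
  linarith

end TwoAdic

/-! ### Density of a chord-closed set of real points -/

/-- A set of real points of the cubic that is stable under negation and under sums of points with
distinct abscissas. -/
structure IsChordClosed (A B C : ℝ) (G : Set (ℝ × ℝ)) : Prop where
  subset : G ⊆ cubicPoints A B C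
  neg_mem : ∀ p ∈ G, (p.1, -p.2) ∈ G
  chordSum_mem : ∀ p ∈ G, ∀ q ∈ G, p.1 ≠ q.1 → chordSum A p q ∈ G

open Filter Topology in
/-- If infinitely many abscissas occur in `G`, then they are not bounded above: differences and
sums of nearby points are close to the point at infinity. -/
lemma IsChordClosed.exists_fst_gt {A B C : ℝ} {G : Set (ℝ × ℝ)} (hG : IsChordClosed A B C G)
    (hinf : (Prod.fst '' G).Infinite)
    (hns : ∀ x, monicCubic A B C x = 0 → 3 * x ^ 2 + 2 * A * x + B ≠ 0) (M : ℝ) :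
    ∃ p ∈ G, M < p.1 := by
  by_contra! hM
  have hlow : ∀ p ∈ G, -(1 + |A| + |B| + |C|) ≤ p.1 := by
    intro p hp
    by_contra! hlt
    have h := hG.subset hp
    simp only [cubicPoints, monicCubic, Set.mem_ofPred_eq] at h
    have hA := neg_abs_le A
    have hA' := le_abs_self A
    have hB := neg_abs_le B
    have hC := le_abs_self C
    have hA0 := abs_nonneg A
    have hB0 := abs_nonneg B
    have hC0 := abs_nonneg C
    set x := p.1
    obtain ⟨z, hz⟩ : ∃ z, z = -x := ⟨_, rfl⟩
    have hx : x = -z := by rw [hz, neg_neg]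
    rw [hx] at h hlt
    have hz1 : 1 < z := by linarith
    have h1 : A * z ^ 2 ≤ |A| * z ^ 2 := by gcongr
    have h2 : -B * z ≤ |B| * z := by gcongr; linarith
    have h3 : |B| * z ≤ |B| * z ^ 2 := by gcongr; nlinarith
    have h4 : |C| ≤ |C| * z ^ 2 := by nlinarith
    have h5 : (|A| + |B| + |C|) * z ^ 2 < z * z ^ 2 := by
      apply mul_lt_mul_of_pos_right _ (by positivity)
      linarith
    nlinarith [sq_nonneg p.2]
  set e := hinf.natEmbedding
  have hmem : ∀ n, ((e n : Prod.fst '' G) : ℝ) ∈ Set.Icc (-(1 + |A| + |B| + |C|)) M := by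
    intro n
    obtain ⟨p, hp, hpe⟩ := (e n).2
    rw [← hpe]
    exact ⟨hlow p hp, hM p hp⟩
  obtain ⟨x, -, φ, hφ, hlim⟩ := isCompact_Icc.tendsto_subseq hmem
  set u : ℕ → ℝ := fun n => ((e (φ n) : Prod.fst '' G) : ℝ)
  have hu : Tendsto u atTop (𝓝 x) := hlim
  have hu' : Tendsto (fun n => u (n + 1)) atTop (𝓝 x) := (tendsto_add_atTop_iff_nat 1).2 hu
  have hne : ∀ n, u n ≠ u (n + 1) := by
    intro n h
    have := hφ.injective (e.injective (Subtype.ext h))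
    omega
  set K : ℝ := |A + 3 * M|
  have hK : 0 ≤ K := abs_nonneg _
  -- Bounded abscissas of `p + q` and `p - q` bound both chord slopes. Adding the two slope bounds
  -- forces the cubic to vanish at the limit `x`; multiplying them forces its derivative to vanish
  -- there too, contradicting `hns`.
  have main : ∀ n, monicCubic A B C (u n) + monicCubic A B C (u (n + 1)) ≤
        K * (u n - u (n + 1)) ^ 2 ∧
      (u n ^ 2 + u n * u (n + 1) + u (n + 1) ^ 2 + A * (u n + u (n + 1)) + B) ^ 2 ≤
        K ^ 2 * (u n - u (n + 1)) ^ 2 := by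
    intro n
    obtain ⟨p, hp, hpu⟩ := (e (φ n)).2
    obtain ⟨q, hq, hqu⟩ := (e (φ (n + 1))).2
    have hpu' : u n = p.1 := hpu.symm
    have hqu' : u (n + 1) = q.1 := hqu.symm
    have hpq : p.1 ≠ q.1 := by rw [← hpu', ← hqu']; exact hne n
    have h1 := hM _ (hG.chordSum_mem p hp q hq hpq)
    have h2 := hM _ (hG.chordSum_mem p hp _ (hG.neg_mem q hq) hpq)
    have hcp := hG.subset hp
    have hcq := hG.subset hq
    rw [hpu', hqu']
    have hpM := hM p hp
    have hqM := hM q hq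
    have hKM : A + 3 * M ≤ K := le_abs_self _
    simp only [chordSum, cubicPoints, monicCubic, Set.mem_ofPred_eq] at h1 h2 hcp hcq ⊢
    have hd : 0 < (p.1 - q.1) ^ 2 := by
      have := sub_ne_zero.2 hpq
      positivity
    have k1 : (q.2 - p.2) ^ 2 ≤ K * (p.1 - q.1) ^ 2 := by
      have : ((q.2 - p.2) / (q.1 - p.1)) ^ 2 ≤ K := by linarith
      rw [div_pow, div_le_iff₀ (by rw [← neg_sub, neg_sq]; exact hd)] at this
      linarith
    have k2 : (q.2 + p.2) ^ 2 ≤ K * (p.1 - q.1) ^ 2 := by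
      have : ((-q.2 - p.2) / (q.1 - p.1)) ^ 2 ≤ K := by linarith
      rw [div_pow, div_le_iff₀ (by rw [← neg_sub, neg_sq]; exact hd)] at this
      linarith
    refine ⟨by linarith, ?_⟩
    have k3 := mul_le_mul k1 k2 (by positivity) (by positivity)
    apply le_of_mul_le_mul_left _ hd
    calc _ = (q.2 ^ 2 - p.2 ^ 2) ^ 2 := by rw [hcp, hcq]; ring
      _ ≤ _ := by linarith
  have hd : Tendsto (fun n => (u n - u (n + 1)) ^ 2) atTop (𝓝 0) := by
    simpa using (hu.sub hu').pow 2
  have hcont : Continuous (monicCubic A B C) := by unfold monicCubic; fun_prop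
  have hcomp : ∀ n, 0 ≤ monicCubic A B C (u n) := by
    intro n
    obtain ⟨p, hp, hpu⟩ := (e (φ n)).2
    have : p.2 ^ 2 = monicCubic A B C p.1 := hG.subset hp
    change 0 ≤ monicCubic A B C ((e (φ n) : Prod.fst '' G) : ℝ)
    rw [← hpu, ← this]
    positivity
  have hf : monicCubic A B C x = 0 := by
    have l1 := ((hcont.tendsto x).comp hu)
    have l2 := ((hcont.tendsto x).comp hu')
    have h1 := le_of_tendsto_of_tendsto' (l1.add l2) (hd.const_mul K) fun n => (main n).1
    have h2 := ge_of_tendsto' l1 hcomp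
    rw [mul_zero] at h1
    linarith
  have hf' : (3 * x ^ 2 + 2 * A * x + B) ^ 2 ≤ 0 := by
    have l1 : Tendsto (fun n => (u n ^ 2 + u n * u (n + 1) + u (n + 1) ^ 2 +
        A * (u n + u (n + 1)) + B) ^ 2) atTop (𝓝 ((x ^ 2 + x * x + x ^ 2 + A * (x + x) + B) ^ 2)) :=
      (((((hu.pow 2).add (hu.mul hu')).add (hu'.pow 2)).add ((hu.add hu').const_mul A)).add_const
        B).pow 2
    have h1 := le_of_tendsto_of_tendsto' l1 (hd.const_mul (K ^ 2)) fun n => (main n).2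
    rw [mul_zero] at h1
    calc _ = (x ^ 2 + x * x + x ^ 2 + A * (x + x) + B) ^ 2 := by ring
      _ ≤ 0 := h1
  exact hns x hf (pow_eq_zero_iff two_ne_zero |>.1 (le_antisymm hf' (sq_nonneg _)))

/-- Adding a point `(X, Y)` close to infinity moves a point of the upper branch a small step to
the left along this branch. -/
lemma chordSum_step {A B C X Y x y L K m M ε : ℝ} (hP : (x, y) ∈ cubicPoints A B C)
    (hQ : (X, Y) ∈ cubicPoints A B C) (hL : |x| ≤ L) (hK : |3 * x ^ 2 + 2 * A * x + B| ≤ K)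
    (hK' : |2 * C + B * x - x ^ 3| ≤ K) (hm : 0 < m) (hmy : m ≤ y) (hyM : y ≤ M)
    (hX1 : 1 ≤ X) (hXL : 20 * L ≤ X) (hKX : 10 * K * X ≤ m * Y) (hMY : 10 * M ≤ Y)
    (hXY : 9 / 10 * X ^ 3 ≤ Y ^ 2) (hε : 13 * M * Y < ε * X ^ 2) :
    x - ε < (chordSum A (x, y) (X, Y)).1 ∧
      (chordSum A (x, y) (X, Y)).1 ≤ x - m * Y / (X + L) ^ 2 ∧
      0 < (chordSum A (x, y) (X, Y)).2 := by
  simp only [cubicPoints, monicCubic, chordSum, Set.mem_ofPred_eq] at *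
  obtain ⟨hL1, hL2⟩ := abs_le.1 hL
  obtain ⟨hE1, hE2⟩ := abs_le.1 hK
  obtain ⟨hF1, hF2⟩ := abs_le.1 hK'
  have hy : 0 < y := by linarith
  have hY : 0 < Y := by linarith
  have hK0 : 0 ≤ K := (abs_nonneg _).trans hK
  have hXx : 0 < X - x := by linarith
  obtain ⟨l, hl⟩ : ∃ l, l = (Y - y) / (X - x) := ⟨_, rfl⟩
  rw [← hl]
  rw [eq_div_iff hXx.ne'] at hl
  obtain ⟨D, hD⟩ : ∃ D, D = x - (l ^ 2 - A - x - X) := ⟨_, rfl⟩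
  -- `D` is the displacement to the left. The term `2 * Y * y` dominates, so `D` is positive and of
  -- order `Y * y / X ^ 2`.
  have hDeq : (X - x) ^ 2 * D =
      2 * Y * y - (3 * x ^ 2 + 2 * A * x + B) * X - (2 * C + B * x - x ^ 3) := by
    rw [hD]
    linear_combination -(l * (X - x) + (Y - y)) * hl - hP - hQ
  have hEX1 : (3 * x ^ 2 + 2 * A * x + B) * X ≤ K * X := by gcongr
  have hEX2 : -(K * X) ≤ (3 * x ^ 2 + 2 * A * x + B) * X := by
    rw [← neg_mul]; gcongr
  have hKX' : K ≤ K * X := le_mul_of_one_le_right hK0 hX1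
  have hmyY : m * Y ≤ y * Y := by gcongr
  have hyMY : y * Y ≤ M * Y := by gcongr
  have hlow : 9 / 5 * (Y * y) ≤ (X - x) ^ 2 * D := by rw [hDeq]; linarith
  have hD0 : 0 < D := pos_of_mul_pos_right
    (lt_of_lt_of_le (by positivity : 0 < 9 / 5 * (Y * y)) hlow) (by positivity)
  refine ⟨?_, ?_, ?_⟩
  · suffices D < ε by linarith
    have hhigh : (X - x) ^ 2 * D ≤ 3 * (M * Y) := by rw [hDeq]; linarith
    have h1 : (X / 2) ^ 2 ≤ (X - x) ^ 2 := by gcongr; linarith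
    have h2 : (X / 2) ^ 2 * D ≤ (X - x) ^ 2 * D := by gcongr
    have h3 : 0 < M * Y := lt_of_lt_of_le (by positivity) hyMY
    have h4 : X ^ 2 * D < X ^ 2 * ε := by linarith
    exact lt_of_mul_lt_mul_left h4 (by positivity)
  · suffices m * Y / (X + L) ^ 2 ≤ D by linarith
    rw [div_le_iff₀ (by have : 0 < X + L := by linarith
                        positivity)]
    have h1 : (X - x) ^ 2 ≤ (X + L) ^ 2 := by gcongr; linarith
    have h2 : (X - x) ^ 2 * D ≤ (X + L) ^ 2 * D := by gcongr
    have h3 : 0 < Y * y := by positivity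
    linarith
  · have e : -(y + l * (l ^ 2 - A - x - X - x)) = l * D - y := by rw [hD]; ring
    rw [e]
    have h1 : (X - x) ^ 3 ≤ (21 / 20 * X) ^ 3 := by gcongr; linarith
    have h2 : (X - x) ^ 3 * (l * D) = (Y - y) * ((X - x) ^ 2 * D) := by rw [← hl]; ring
    have h3 : 9 / 10 * Y * (9 / 5 * (Y * y)) ≤ (Y - y) * ((X - x) ^ 2 * D) := by
      gcongr
      · linarith
      · linarith
    have h4 : (X - x) ^ 3 * y < (X - x) ^ 3 * (l * D) := by
      rw [h2]
      refine lt_of_lt_of_le ?_ h3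
      have h5 : (X - x) ^ 3 * y ≤ (21 / 20 * X) ^ 3 * y := by gcongr
      have h6 : 9 / 10 * X ^ 3 * y ≤ Y ^ 2 * y := by gcongr
      have h7 : 0 < X ^ 3 * y := by positivity
      linarith
    have := lt_of_mul_lt_mul_left h4 (by positivity)
    linarith

/-- Points of large abscissa on the cubic satisfy the size conditions of `chordSum_step`. -/
lemma exists_bound_of_cubicPoints (A B C L K M : ℝ) {m ε : ℝ} (hm : 0 < m) (hε : 0 < ε) :
    ∃ N : ℝ, ∀ X Y : ℝ, (X, Y) ∈ cubicPoints A B C → 0 ≤ Y → N < X →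
      1 ≤ X ∧ 20 * L ≤ X ∧ 10 * K * X ≤ m * Y ∧ 10 * M ≤ Y ∧ 9 / 10 * X ^ 3 ≤ Y ^ 2 ∧
        13 * M * Y < ε * X ^ 2 := by
  refine ⟨1 + 20 * |L| + 120 * (K / m) ^ 2 + 120 * M ^ 2 + 200 * (M / ε) ^ 2 +
    10 * (|A| + |B| + |C|), ?_⟩
  intro X Y h hY hX
  simp only [cubicPoints, monicCubic, Set.mem_ofPred_eq] at h
  have hL0 := abs_nonneg L
  have hL := le_abs_self L
  have hA0 := abs_nonneg A
  have hB0 := abs_nonneg B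
  have hC0 := abs_nonneg C
  have p1 := sq_nonneg (K / m)
  have p2 := sq_nonneg M
  have p3 := sq_nonneg (M / ε)
  have hX1 : 1 ≤ X := by linarith
  have hX0 : 0 < X := by linarith
  have hXX : X ≤ X ^ 2 := by nlinarith
  have hXX1 : 1 ≤ X ^ 2 := by nlinarith
  have hrest : |A * X ^ 2 + B * X + C| ≤ 1 / 10 * X ^ 3 := by
    calc |A * X ^ 2 + B * X + C| ≤ |A * X ^ 2| + |B * X| + |C| := abs_add_three _ _ _
      _ = |A| * X ^ 2 + |B| * X + |C| * 1 := by
        rw [abs_mul, abs_mul, abs_of_pos hX0, abs_of_pos (by positivity : 0 < X ^ 2), mul_one]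
      _ ≤ |A| * X ^ 2 + |B| * X ^ 2 + |C| * X ^ 2 := by gcongr
      _ = (|A| + |B| + |C|) * X ^ 2 := by ring
      _ ≤ (1 / 10 * X) * X ^ 2 := by gcongr; linarith
      _ = 1 / 10 * X ^ 3 := by ring
  obtain ⟨r1, r2⟩ := abs_le.1 hrest
  have hlow : 9 / 10 * X ^ 3 ≤ Y ^ 2 := by linarith
  have hhigh : Y ^ 2 ≤ 11 / 10 * X ^ 3 := by linarith
  refine ⟨hX1, by linarith, ?_, ?_, hlow, ?_⟩
  · apply le_of_sq_le_sq _ (by positivity)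
    have h1 : 120 * (K / m) ^ 2 ≤ X := by linarith
    rw [div_pow, ← mul_div_assoc, div_le_iff₀ (by positivity)] at h1
    calc (10 * K * X) ^ 2 = 100 * K ^ 2 * X ^ 2 := by ring
      _ ≤ (9 / 10 * (X * m ^ 2)) * X ^ 2 := by gcongr ?_ * X ^ 2; linarith [sq_nonneg K]
      _ = m ^ 2 * (9 / 10 * X ^ 3) := by ring
      _ ≤ m ^ 2 * Y ^ 2 := by gcongr
      _ = (m * Y) ^ 2 := by ring
  · apply le_of_sq_le_sq _ hY
    have h1 : 120 * M ^ 2 ≤ X := by linarith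
    have h2 : X ≤ X ^ 3 := by nlinarith
    nlinarith
  · apply lt_of_pow_lt_pow_left₀ 2 (by positivity)
    have h1 : 200 * (M / ε) ^ 2 < X := by linarith
    rw [div_pow, ← mul_div_assoc, div_lt_iff₀ (by positivity)] at h1
    calc (13 * M * Y) ^ 2 = 169 * M ^ 2 * Y ^ 2 := by ring
      _ ≤ 169 * M ^ 2 * (11 / 10 * X ^ 3) := by gcongr
      _ = (1859 / 10 * M ^ 2) * X ^ 3 := by ring
      _ ≤ (200 * M ^ 2) * X ^ 3 := by gcongr; norm_num
      _ < (X * ε ^ 2) * X ^ 3 := by gcongr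
      _ = (ε * X ^ 2) ^ 2 := by ring

/-- Abscissas of a chord-closed set accumulating at infinity are dense to the left of any point
of the set, as long as the cubic stays positive. -/
lemma IsChordClosed.exists_near {A B C : ℝ} {G : Set (ℝ × ℝ)} (hG : IsChordClosed A B C G)
    (hunb : ∀ M, ∃ p ∈ G, M < p.1) {p₀ : ℝ × ℝ} (hp₀ : p₀ ∈ G) (hy₀ : 0 < p₀.2) {t : ℝ}
    (ht : t ≤ p₀.1) (hpos : ∀ x ∈ Set.Icc t p₀.1, 0 < monicCubic A B C x) {ε : ℝ} (hε : 0 < ε) :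
    ∃ p ∈ G, |p.1 - t| < ε := by
  obtain ⟨L, hL⟩ := isCompact_Icc.exists_bound_of_continuousOn (s := Set.Icc t p₀.1)
    (f := fun x : ℝ => x) (by fun_prop)
  obtain ⟨K₁, hK₁⟩ := isCompact_Icc.exists_bound_of_continuousOn (s := Set.Icc t p₀.1)
    (f := fun x : ℝ => 3 * x ^ 2 + 2 * A * x + B) (by fun_prop)
  obtain ⟨K₂, hK₂⟩ := isCompact_Icc.exists_bound_of_continuousOn (s := Set.Icc t p₀.1)
    (f := fun x : ℝ => 2 * C + B * x - x ^ 3) (by fun_prop)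
  have hcont : Continuous (monicCubic A B C) := by unfold monicCubic; fun_prop
  obtain ⟨M, hM⟩ := isCompact_Icc.exists_bound_of_continuousOn (s := Set.Icc t p₀.1)
    hcont.continuousOn
  obtain ⟨b, hb, hbmin⟩ := isCompact_Icc.exists_isMinOn (s := Set.Icc t p₀.1)
    ⟨t, le_rfl, ht⟩ hcont.continuousOn
  have hδ := hpos b hb
  set δ := monicCubic A B C b
  simp only [Real.norm_eq_abs] at hL hK₁ hK₂ hM
  have hm : 0 < √δ := Real.sqrt_pos.2 hδ
  obtain ⟨N, hN⟩ := exists_bound_of_cubicPoints A B C L (max K₁ K₂) (√M) hm hε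
  obtain ⟨q, hq, hqN, hqY⟩ : ∃ q ∈ G, N < q.1 ∧ 0 ≤ q.2 := by
    obtain ⟨q, hq, hqN⟩ := hunb N
    rcases le_total 0 q.2 with h | h
    · exact ⟨q, hq, hqN, h⟩
    · exact ⟨_, hG.neg_mem q hq, hqN, neg_nonneg.2 h⟩
  obtain ⟨n1, n2, n3, n4, n5, n6⟩ := hN q.1 q.2 (hG.subset hq) hqY hqN
  have hL0 : 0 ≤ L := (abs_nonneg _).trans (hL t ⟨le_rfl, ht⟩)
  have hY : 0 < q.2 := by
    rcases hqY.lt_or_eq with h | h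
    · exact h
    · rw [← h] at n5
      have : 0 < q.1 ^ 3 := by positivity
      linarith
  set c := √δ * q.2 / (q.1 + L) ^ 2
  have hc : 0 < c := by positivity
  by_contra! hfar
  -- Each step is shorter than `ε`, so the walk cannot jump over the window around `t`; each is at
  -- least `c`, so it cannot stay to the right of the window forever.
  have key : ∀ n : ℕ, ∃ p ∈ G, 0 < p.2 ∧ t + ε ≤ p.1 ∧ p.1 ≤ p₀.1 - n * c := by
    intro n
    induction n with
    | zero =>
      refine ⟨p₀, hp₀, hy₀, ?_, by simp⟩
      have := hfar p₀ hp₀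
      rw [abs_of_nonneg (by linarith)] at this
      linarith
    | succ n ih =>
      obtain ⟨p, hp, hy, hpt, hpn⟩ := ih
      have hnc : 0 ≤ n * c := by positivity
      have hpI : p.1 ∈ Set.Icc t p₀.1 := ⟨by linarith, by linarith⟩
      have hpc : p.2 ^ 2 = monicCubic A B C p.1 := hG.subset hp
      have hne : p.1 ≠ q.1 := by
        have h1 := (abs_le.1 (hL p.1 hpI)).2
        intro h
        linarith
      obtain ⟨s1, s2, s3⟩ := chordSum_step (ε := ε) (hG.subset hp) (hG.subset hq) (hL _ hpI)
        ((hK₁ _ hpI).trans (le_max_left _ _)) ((hK₂ _ hpI).trans (le_max_right _ _)) hm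
        (Real.sqrt_le_iff.2 ⟨hy.le, by rw [hpc]; exact hbmin hpI⟩)
        (Real.le_sqrt_of_sq_le (by rw [hpc]; exact (le_abs_self _).trans (hM _ hpI)))
        n1 n2 n3 n4 n5 n6
      have hr := hG.chordSum_mem p hp q hq hne
      refine ⟨_, hr, s3, ?_, ?_⟩
      · have := hfar _ hr
        rw [abs_of_nonneg (by linarith)] at this
        linarith
      · push_cast
        linarith
  obtain ⟨n, hn⟩ := exists_nat_gt ((p₀.1 - t) / c)
  rw [div_lt_iff₀ hc] at hn
  obtain ⟨p, -, -, h1, h2⟩ := key n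
  linarith

/-! ### The elliptic curve of the theorem -/

/-- The real points of the cubic with rational coordinates. -/
def rationalCubicPoints (A B C : ℚ) : Set (ℝ × ℝ) :=
  (fun p : ℚ × ℚ => ((p.1 : ℝ), (p.2 : ℝ))) '' cubicPoints A B C

lemma isChordClosed_rationalCubicPoints (A B C : ℚ) :
    IsChordClosed A B C (rationalCubicPoints A B C) where
  subset := by
    rintro _ ⟨p, hp, rfl⟩
    have : p.2 ^ 2 = monicCubic A B C p.1 := hp
    change (p.2 : ℝ) ^ 2 = monicCubic (A : ℝ) B C p.1
    have h := congrArg (fun q : ℚ => (q : ℝ)) this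
    simp only [monicCubic] at h ⊢
    exact_mod_cast h
  neg_mem := by
    rintro _ ⟨p, hp, rfl⟩
    refine ⟨(p.1, -p.2), ?_, by simp⟩
    change (-p.2) ^ 2 = monicCubic A B C p.1
    rw [neg_sq]
    exact hp
  chordSum_mem := by
    rintro _ ⟨p, hp, rfl⟩ _ ⟨q, hq, rfl⟩ h
    refine ⟨chordSum A p q, chordSum_mem_cubicPoints hp hq fun h' => h (by simp [h']), ?_⟩
    simp [chordSum]

lemma exists_rational_point_near {t : ℝ} (ht : t ≤ 0)
    (hpos : ∀ x ∈ Set.Icc t 0, 0 < monicCubic (2121 : ℝ) (-14406912) 13182713856 x) {ε : ℝ}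
    (hε : 0 < ε) :
    ∃ X Y : ℚ, Y ^ 2 = monicCubic 2121 (-14406912) 13182713856 X ∧ |(X : ℝ) - t| < ε := by
  have hG := isChordClosed_rationalCubicPoints 2121 (-14406912) 13182713856
  push_cast at hG
  have hinf : (Prod.fst '' rationalCubicPoints 2121 (-14406912) 13182713856).Infinite := by
    have h1 : ((67093 / 36 : ℚ), (2840201 / 216 : ℚ)) ∈
        cubicPoints ((2121 : ℤ) : ℚ) ((-14406912 : ℤ) : ℚ) ((13182713856 : ℤ) : ℚ) := by
      simp only [cubicPoints, monicCubic, Set.mem_ofPred_eq]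
      norm_num
    have hn : (2 : ℚ) ≤ padicNorm 2 (67093 / 36 : ℚ) := by
      have e4 : padicNorm 2 (4 : ℚ) = 1 / 4 := by
        rw [show (4 : ℚ) = ((2 : ℕ) : ℚ) * ((2 : ℕ) : ℚ) by norm_num, padicNorm.mul,
          padicNorm.padicNorm_p_of_prime]
        norm_num
      have e9 : padicNorm 2 (9 : ℚ) = 1 :=
        (padicNorm.nat_eq_one_iff (p := 2) 9).2 (by norm_num)
      have e1 : padicNorm 2 (67093 : ℚ) = 1 :=
        (padicNorm.nat_eq_one_iff (p := 2) 67093).2 (by norm_num)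
      rw [padicNorm.div, show (36 : ℚ) = 4 * 9 by norm_num, padicNorm.mul, e4, e9, e1]
      norm_num
    have h2 := infinite_fst_image_cubicPoints h1 hn
    push_cast at h2
    have h3 := h2.image (f := fun q : ℚ => (q : ℝ)) Rat.cast_injective.injOn
    rw [Set.image_image] at h3
    rw [rationalCubicPoints, Set.image_image]
    exact h3
  have hunb := hG.exists_fst_gt hinf (by
    intro x h0 h1
    rw [monicCubic] at h0
    have : (1 : ℝ) = 0 := by
      -- A Bézout identity for the cubic and its derivative: they are coprime, so there is no
      -- singular point.
      linear_combination (-7893107867 / 4154848235004100608 - 5302153 / 8309696470008201216 * x) *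
        h0 + (-145855 / 80684535808 + 723512515 / 923299607778689024 * x +
          5302153 / 24929089410024603648 * x ^ 2) * h1
    exact one_ne_zero this)
  obtain ⟨_, ⟨p, hp, rfl⟩, h⟩ := hG.exists_near hunb (p₀ := (0, 114816))
    ⟨(0, 114816), by simp only [cubicPoints, monicCubic, Set.mem_ofPred_eq]; norm_num, by simp⟩
    (by norm_num) ht hpos hε
  exact ⟨p.1, p.2, hp, h⟩

lemma exists_root_strict_pos :
    ∃ a₁ : ℝ, a₁ ^ 3 - 2019 / 529 * a₁ ^ 2 - 777 / 92 * a₁ - 1 = 0 ∧ |a₁ - 5.41147624| < 5e-9 ∧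
      ∀ t, a₁ < t → 0 < t ^ 3 - 2019 / 529 * t ^ 2 - 777 / 92 * t - 1 := by
  have hcont : ContinuousOn (fun t : ℝ => t ^ 3 - 2019 / 529 * t ^ 2 - 777 / 92 * t - 1)
      (Set.Icc (5.41147624 - 1 / 250000000) (5.41147624 + 1 / 250000000)) := by fun_prop
  obtain ⟨a₁, ⟨h1, h2⟩, h⟩ := intermediate_value_Icc (by norm_num) hcont
    (show (0 : ℝ) ∈ _ from ⟨by norm_num, by norm_num⟩)
  refine ⟨a₁, h, ?_, fun t ht => ?_⟩
  · rw [abs_lt]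
    constructor <;> linarith
  · have h : a₁ ^ 3 - 2019 / 529 * a₁ ^ 2 - 777 / 92 * a₁ - 1 = 0 := h
    have ha : 5 < a₁ := by norm_num at h1; linarith
    have hq : 0 < t ^ 2 + t * a₁ + a₁ ^ 2 - 2019 / 529 * (t + a₁) - 777 / 92 := by
      nlinarith [mul_pos (sub_pos.2 (ha.trans ht)) (sub_pos.2 ha)]
    nlinarith [mul_pos (sub_pos.2 ht) hq]

lemma div_sub_four_mem_lynessNinePeriodicParams {X Y : ℚ} (hX : X < 0)
    (h : Y ^ 2 = monicCubic 2121 (-14406912) 13182713856 X) :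
    4 - 7488 / X ∈ lynessNinePeriodicParams := by
  have ha : 4 < 4 - 7488 / X := by
    have := div_neg_of_pos_of_neg (show (0 : ℚ) < 7488 by norm_num) hX
    linarith
  obtain ⟨a, hadef⟩ : ∃ a, a = 4 - 7488 / X := ⟨_, rfl⟩
  rw [← hadef] at ha ⊢
  have hX' : X = -7488 / (a - 4) := by
    have : a - 4 ≠ 0 := by linarith
    rw [eq_div_iff this, hadef]
    have := hX.ne
    field_simp
    ring
  have h4 : a - 4 ≠ 0 := by linarith
  have h2 : 2 * a + 1 ≠ 0 := by linarith
  refine mem_lynessNinePeriodicParams (d := Y * (a - 4) / (9984 * (2 * a + 1))) ha ?_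
  rw [monicCubic, hX'] at h
  rw [div_pow, mul_pow, h]
  field_simp
  ring

lemma mem_closure_lynessNinePeriodicParams {a : ℝ} (ha : 4 < a)
    (hpos : ∀ t, a ≤ t → 0 < t ^ 3 - 2019 / 529 * t ^ 2 - 777 / 92 * t - 1) :
    a ∈ closure ((fun q : ℚ => (q : ℝ)) '' lynessNinePeriodicParams) := by
  obtain ⟨x, hx⟩ : ∃ x, x = -7488 / (a - 4) := ⟨_, rfl⟩
  have ha4 : 0 < a - 4 := by linarith
  have hx0 : x < 0 := by rw [hx]; exact div_neg_of_neg_of_pos (by norm_num) ha4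
  have hax : a = 4 - 7488 / x := by rw [hx]; field_simp; ring
  have hcub : ∀ z ∈ Set.Icc x 0, 0 < monicCubic (2121 : ℝ) (-14406912) 13182713856 z := by
    rintro z ⟨hxz, hz0⟩
    rcases hz0.lt_or_eq with hz | rfl
    · obtain ⟨t, ht⟩ : ∃ t, t = 4 - 7488 / z := ⟨_, rfl⟩
      have hat : a ≤ t := by
        rw [ht, hax]
        have : 7488 / z ≤ 7488 / x := by
          have := one_div_le_one_div_of_neg_of_le hz hxz
          rw [div_eq_mul_one_div, div_eq_mul_one_div 7488 x]
          linarith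
        linarith
      have ht4 : 0 < t - 4 := by linarith
      have hzt : z = -7488 / (t - 4) := by
        rw [eq_div_iff ht4.ne', ht]
        have := hz.ne
        field_simp
        ring
      have h := hpos t hat
      have e : monicCubic (2121 : ℝ) (-14406912) 13182713856 z =
          2496 ^ 2 * 2116 * (t ^ 3 - 2019 / 529 * t ^ 2 - 777 / 92 * t - 1) / (t - 4) ^ 3 := by
        rw [monicCubic, hzt]
        field_simp
        ring
      rw [e]
      positivity
    · norm_num [monicCubic]
  have hmem : x ∈ closure ((fun q : ℚ => (q : ℝ)) ''
      {X : ℚ | X < 0 ∧ ∃ Y, Y ^ 2 = monicCubic 2121 (-14406912) 13182713856 X}) := by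
    rw [Metric.mem_closure_iff]
    intro ε hε
    -- The bound `-x` keeps `X` negative.
    obtain ⟨X, Y, hXY, hX⟩ := exists_rational_point_near hx0.le hcub
      (show 0 < min ε (-x) from lt_min hε (by linarith))
    refine ⟨X, ⟨X, ⟨?_, Y, hXY⟩, rfl⟩, ?_⟩
    · have := (abs_lt.1 (hX.trans_le (min_le_right _ _))).2
      exact_mod_cast (show (X : ℝ) < 0 by linarith)
    · rw [dist_comm, Real.dist_eq]
      exact hX.trans_le (min_le_left _ _)
  have hcont : ContinuousAt (fun z : ℝ => 4 - 7488 / z) x :=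
    continuousAt_const.sub (continuousAt_const.div continuousAt_id hx0.ne)
  have h := hcont.continuousWithinAt.mem_closure_image hmem
  rw [hax]
  refine closure_mono ?_ h
  rintro _ ⟨_, ⟨X, ⟨hX, Y, hXY⟩, rfl⟩, rfl⟩
  exact ⟨_, div_sub_four_mem_lynessNinePeriodicParams hX hXY, by push_cast; rfl⟩

theorem theorem2 :
    lynessNinePeriodicParams.Infinite ∧
    ∃ a₁ : ℝ,
      IsGreatest {t : ℝ | t ^ 3 - 2019 / 529 * t ^ 2 - 777 / 92 * t - 1 = 0} a₁ ∧
      |a₁ - 5.41147624| < 5e-9 ∧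
      Set.Ici a₁ ⊆ closure ((fun q : ℚ => (q : ℝ)) '' lynessNinePeriodicParams) := by
  obtain ⟨a₁, hroot, happrox, hpos⟩ := exists_root_strict_pos
  have h4 : 4 < a₁ := by
    have := (abs_lt.1 happrox).1
    norm_num at this
    linarith
  have hsub : Set.Ici a₁ ⊆ closure ((fun q : ℚ => (q : ℝ)) '' lynessNinePeriodicParams) := by
    -- The cubic vanishes at `a₁`, so positivity, and with it the density argument, is available
    -- only to the right of `a₁`.
    rw [← closure_Ioi]
    refine closure_minimal (fun a ha => ?_) isClosed_closure
    have ha : a₁ < a := ha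
    exact mem_closure_lynessNinePeriodicParams (h4.trans ha) fun t ht => hpos t (ha.trans_le ht)
  refine ⟨fun hfin => ?_, a₁, ⟨hroot, fun t ht => ?_⟩, happrox, hsub⟩
  · have hfin' := hfin.image fun q : ℚ => (q : ℝ)
    rw [hfin'.isClosed.closure_eq] at hsub
    exact Set.Ici_infinite a₁ (hfin'.subset hsub)
  · by_contra! hlt
    exact (hpos t hlt).ne' ht
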